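/- For a finite simple graph $G$ let $d_G(v)$ be the degree of the vertex $v$ and let $$GA(G)=\sum_{uv\in E(G)}\frac{2\sqrt{d_G(u)d_G(v)}}{d_G(u)+d_G(v)}$$ be its geometric-arithmetic index. A graph is called unicyclic if it is connected and contains exactly one cycle. For $n\ge 3$ let $C_n$ be the cycle on $n$ vertices, and let $S_{n;3}$ be the graph on $n$ vertices obtained from a triangle by attaching $n-3$ pendant vertices to one of its vertices. Theorem. Let $n\ge 3$. The graphs $S_{n;3}$ and $C_n$ are unicyclic, $$GA(S_{n;3})=1+\frac{\bigl(2n^2+4(\sqrt2-1)n-6\bigr)\sqrt{n-1}}{n(n+1)},\qquad GA(C_n)=n,$$ and every unicyclic graph $G$ on $n$ vertices satisfies $$GA(S_{n;3})\le GA(G)\le GA(C_n).$$ Thus, among the unicyclic graphs on $n$ vertices, $GA$ attains its minimum at $S_{n;3}$ and its maximum at $C_n$. -/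

import Mathlib

namespace SimpleGraph

open Classical in
/-- The geometric-arithmetic index of a finite simple graph: the sum over the edges `uv` of
`2 √(d(u) d(v)) / (d(u) + d(v))`. -/
noncomputable def gaIndex {V : Type*} [Fintype V] (G : SimpleGraph V) : ℝ :=
  ∑ e ∈ G.edgeFinset,
    Sym2.lift ⟨fun u v : V =>
      2 * Real.sqrt ((G.degree u : ℝ) * (G.degree v : ℝ)) /
        ((G.degree u : ℝ) + (G.degree v : ℝ)),
      fun u v => by
        dsimp only
        rw [mul_comm (G.degree u : ℝ) (G.degree v : ℝ),
          add_comm (G.degree u : ℝ) (G.degree v : ℝ)]⟩ e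

/-- A graph is unicyclic if it is connected and contains exactly one cycle. A cycle of `G` is a
subgraph of `G` traced by a closed walk that is a cycle, so that neither the starting point nor the
direction of the walk matters. -/
def IsUnicyclic {V : Type*} (G : SimpleGraph V) : Prop :=
  G.Connected ∧
    ∃! H : G.Subgraph, ∃ (v : V) (c : G.Walk v v), c.IsCycle ∧ c.toSubgraph = H

/-- For `n ≥ 3`, the graph on `n` vertices obtained from the triangle on `0, 1, 2` by attaching the
remaining `n - 3` vertices `3, …, n - 1` as pendant vertices at the vertex `0`. -/
def trianglePendant (n : ℕ) : SimpleGraph (Fin n) :=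
  SimpleGraph.fromRel fun i j =>
    (i.val < 3 ∧ j.val < 3) ∨ (i.val = 0 ∧ 3 ≤ j.val)

end SimpleGraph

/-! Unicyclic means connected with as many edges as vertices. Each summand is a ratio of a geometric
to an arithmetic mean, hence at most 1, and there are `n` edges; this gives the upper bound,
attained by the 2-regular `C_n`.

For the lower bound let `v` have maximum degree `d` and put `n = d + k`. The weight of an edge
depends only on the ratio of its end degrees and falls as that ratio moves away from 1
(`gaRatio_le`), so bounds on degrees bound weights from below. Edges of the cycle have both ends of
degree at least 2, and at least one of them avoids `v`. An end `w ≠ v` satisfies `d(w) ≤ k + 1`,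
since `d(v) + d(w) ≤ n + 1`. If `k = 1`, these facts already give the index of `S_{n;3}`, which is
`gaTriangle (n - 1)`.

If `d ≤ 2`, the graph is 2-regular with index `n`. Otherwise `k ≥ 2` remains, where there is room
for the crude bound `gaTriangle x ≤ 2√x + 1`, except for `k = 2`. When `d ≤ k + 1`, all ratios are
so small that the maximum degree alone suffices. When `d > k + 1`, the `d` edges at `v` give nearly
`2√d`, and the other `k` edges pay for the tangent-line increment from `√d` to `√(d + k - 1)`. The
pairs `(d, k) = (3, 2), (3, 3), (4, 2), (5, 3)` are checked numerically. -/

namespace SimpleGraph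

/-! ### Unicyclic graphs and edge counts -/

section Unicyclic

variable {V : Type*} {G : SimpleGraph V}

/-- Removing an edge of a cycle from a connected graph with one edge more than a spanning tree
leaves a tree. -/
theorem Connected.isAcyclic_deleteEdges_of_mem_cycle [Fintype V] [Fintype G.edgeSet]
    (hG : G.Connected) (hcard : G.edgeFinset.card = Fintype.card V) {v : V} {c : G.Walk v v}
    (hc : c.IsCycle) {e : Sym2 V} (he : e ∈ c.edges) : (G.deleteEdges {e}).IsAcyclic := by
  classical
  have heG : e ∈ G.edgeSet := c.edges_subset_edgeSet he
  have hbr : ¬ G.IsBridge e := fun h => h.notMem_edges_of_isCycle hc he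
  induction e with | h x y =>
  have hconn := hG.connected_delete_edge_of_not_isBridge hbr
  refine (isTree_iff_connected_and_card.2 ⟨hconn, ?_⟩).isAcyclic
  rw [Nat.card_eq_fintype_card, Nat.card_eq_fintype_card, ← edgeFinset_card, ← hcard]
  have : (G.deleteEdges {s(x, y)}).edgeFinset = G.edgeFinset.erase s(x, y) := by
    ext f; simp [and_comm]
  rw [this, Finset.card_erase_add_one (by simpa using heG)]

/-- A connected graph with as many edges as vertices is unicyclic. -/
theorem Connected.isUnicyclic_of_card_edgeFinset [Fintype V] [Fintype G.edgeSet]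
    (hG : G.Connected) (hcard : G.edgeFinset.card = Fintype.card V) : G.IsUnicyclic := by
  refine ⟨hG, ?_⟩
  have hcyc : ¬ G.IsAcyclic := fun h => by
    have := (IsTree.mk hG h).card_edgeFinset
    omega
  simp only [IsAcyclic, not_forall, not_not] at hcyc
  obtain ⟨v, c, hc⟩ := hcyc
  have key : ∀ {u w : V} (p : G.Walk u u) (q : G.Walk w w), p.IsCycle → q.IsCycle →
      p.toSubgraph ≤ q.toSubgraph := by
    intro u w p q hp hq
    rw [Walk.toSubgraph_le_iff hp.not_nil, Walk.edgeSet_toSubgraph]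
    intro e he
    -- If `e` lies on `p` but not on `q`, then `q` survives the deletion of `e`, which leaves a
    -- tree.
    by_contra hne
    refine hG.isAcyclic_deleteEdges_of_mem_cycle hcard hp he _
      (Walk.IsCycle.toDeleteEdges _ {e} hq fun f hf hfe => hne ?_)
    rw [Set.mem_singleton_iff] at hfe
    exact hfe ▸ hf
  refine ⟨c.toSubgraph, ⟨v, c, hc, rfl⟩, ?_⟩
  rintro H ⟨w, q, hq, rfl⟩
  exact le_antisymm (key q c hq hc) (key c q hc hq)

/-- A unicyclic graph has as many edges as vertices. -/
theorem IsUnicyclic.card_edgeFinset [Fintype V] [Fintype G.edgeSet] (hG : G.IsUnicyclic) :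
    G.edgeFinset.card = Fintype.card V := by
  classical
  obtain ⟨hconn, H, ⟨v, c, hc, rfl⟩, huniq⟩ := hG
  obtain ⟨e, he⟩ : ∃ e, e ∈ c.edges := by
    refine List.exists_mem_of_length_pos ?_
    have := hc.three_le_length
    rw [Walk.length_edges]; omega
  have heG : e ∈ G.edgeSet := c.edges_subset_edgeSet he
  have hbr : ¬ G.IsBridge e := fun h => h.notMem_edges_of_isCycle hc he
  have hacyc : (G.deleteEdges {e}).IsAcyclic := by
    intro w q hq
    have hle : G.deleteEdges {e} ≤ G := deleteEdges_le _
    -- A cycle surviving the deletion of `e` would be the unique cycle of `G`, which contains `e`.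
    have h := huniq _ ⟨w, q.mapLe hle, hq.mapLe hle, rfl⟩
    have he' : e ∈ (q.mapLe hle).edges := by
      rw [← Walk.mem_edges_toSubgraph, h, Walk.mem_edges_toSubgraph]; exact he
    rw [Walk.edges_mapLe_eq_edges] at he'
    simpa using q.edges_subset_edgeSet he'
  induction e with | h x y =>
  have htree : (G.deleteEdges {s(x, y)}).IsTree :=
    ⟨hconn.connected_delete_edge_of_not_isBridge hbr, hacyc⟩
  have : (G.deleteEdges {s(x, y)}).edgeFinset = G.edgeFinset.erase s(x, y) := by
    ext f; simp [and_comm]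
  rw [← htree.card_edgeFinset, this, Finset.card_erase_add_one (by simpa using heG)]

/-- The edges of a cycle: there are at least three of them, their ends have degree at least two,
and at most two of them meet at any vertex. -/
theorem Walk.IsCycle.exists_edges [Fintype V] [DecidableEq V] [DecidableRel G.Adj] {u : V}
    {c : G.Walk u u} (hc : c.IsCycle) :
    ∃ C ⊆ G.edgeFinset, 3 ≤ C.card ∧ (∀ e ∈ C, ∀ w ∈ e, 2 ≤ G.degree w) ∧
      ∀ w, (C.filter (w ∈ ·)).card ≤ 2 := by
  refine ⟨c.edges.toFinset, ?_, ?_, ?_, ?_⟩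
  · intro e he
    simpa using c.edges_subset_edgeSet (List.mem_toFinset.1 he)
  · rw [List.toFinset_card_of_nodup hc.edges_nodup, Walk.length_edges]
    exact hc.three_le_length
  · intro e he w hw
    have hws : w ∈ c.support := Walk.mem_support_of_mem_edges (List.mem_toFinset.1 he) hw
    rw [← hc.ncard_neighborSet_toSubgraph_eq_two hws, ← card_neighborSet_eq_degree,
      ← Nat.card_eq_fintype_card, Nat.card_coe_set_eq]
    exact Set.ncard_le_ncard (c.toSubgraph.neighborSet_subset w) (Set.toFinite _)
  · intro w
    by_cases hws : w ∈ c.support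
    · classical
      rw [← hc.ncard_neighborSet_toSubgraph_eq_two hws, Set.ncard_eq_toFinset_card']
      refine le_trans (Finset.card_le_card (t := ((c.toSubgraph.neighborSet w).toFinset).image
        (fun x => s(w, x))) ?_) Finset.card_image_le
      intro e he
      rw [Finset.mem_filter, List.mem_toFinset] at he
      obtain ⟨he, x, rfl⟩ := he
      refine Finset.mem_image.2 ⟨x, ?_, rfl⟩
      rw [Set.mem_toFinset, Subgraph.mem_neighborSet, Walk.adj_toSubgraph_iff_mem_edges]
      exact he
    · rw [Finset.filter_eq_empty_iff.2]
      · simp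
      · intro e he hw
        exact hws (Walk.mem_support_of_mem_edges (List.mem_toFinset.1 he) hw)

/-- Two distinct vertices have at most one incident edge in common. -/
theorem degree_add_degree_le_card_edgeFinset_add_one [Fintype V] [DecidableRel G.Adj]
    {v w : V} (h : v ≠ w) : G.degree v + G.degree w ≤ G.edgeFinset.card + 1 := by
  classical
  rw [← card_incidenceFinset_eq_degree, ← card_incidenceFinset_eq_degree,
    ← Finset.card_union_add_card_inter]
  gcongr
  · exact Finset.union_subset (G.incidenceFinset_subset v) (G.incidenceFinset_subset w)
  · refine (Finset.card_le_card (t := {s(v, w)}) fun e he => ?_).trans (by simp)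
    simp only [Finset.mem_inter, mem_incidenceFinset] at he
    simpa using (Sym2.mem_and_mem_iff h).1 ⟨he.1.2, he.2.2⟩

end Unicyclic

end SimpleGraph

/-! ### Edge weights as a function of the degree ratio -/

namespace SimpleGraph

/-- The geometric-arithmetic weight of an edge whose end degrees have ratio `r`. -/
noncomputable def gaRatio (r : ℝ) : ℝ := 2 * Real.sqrt r / (1 + r)

theorem gaRatio_one : gaRatio 1 = 1 := by norm_num [gaRatio]

/-- Among pairs of numbers in `[c, M]`, the pair of end points minimizes the ratio of the
geometric to the arithmetic mean. -/
theorem gaRatio_le {a b c M : ℝ} (hc : 0 < c) (hca : c ≤ a) (hcb : c ≤ b) (haM : a ≤ M)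
    (hbM : b ≤ M) : gaRatio (M / c) ≤ 2 * Real.sqrt (a * b) / (a + b) := by
  have ha : 0 < a := hc.trans_le hca
  have hb : 0 < b := hc.trans_le hcb
  obtain ⟨r, rfl⟩ : ∃ r, M = r * c := ⟨M / c, by field_simp⟩
  have hr : 0 < r := pos_of_mul_pos_left (ha.trans_le haM) hc.le
  rw [mul_div_cancel_right₀ _ hc.ne', gaRatio, div_le_div_iff₀ (by positivity) (by positivity),
    mul_assoc, mul_assoc]
  gcongr 2 * ?_
  rw [← Real.sqrt_sq (show 0 ≤ a + b by positivity), ← Real.sqrt_sq (show 0 ≤ 1 + r by positivity),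
    ← Real.sqrt_mul (by positivity), ← Real.sqrt_mul (by positivity)]
  refine Real.sqrt_le_sqrt ?_
  have h1 : b ≤ r * a := hbM.trans (by gcongr)
  have h2 : a ≤ r * b := haM.trans (by gcongr)
  -- The difference of the squared sides is `(r a - b)(r b - a)`.
  nlinarith [mul_nonneg (sub_nonneg.2 h1) (sub_nonneg.2 h2)]

theorem gaRatio_anti {p q : ℝ} (hp : 1 ≤ p) (hpq : p ≤ q) : gaRatio q ≤ gaRatio p := by
  have := gaRatio_le (a := 1) (b := p) one_pos le_rfl hp (hp.trans hpq) hpq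
  rwa [div_one, one_mul] at this

/-- Geometric and arithmetic means. -/
theorem two_mul_sqrt_mul_div_add_le_one {a b : ℝ} (ha : 0 ≤ a) (hb : 0 ≤ b) :
    2 * Real.sqrt (a * b) / (a + b) ≤ 1 := by
  refine div_le_one_of_le₀ ?_ (by positivity)
  have := sq_nonneg (√a - √b)
  rw [Real.sqrt_mul ha]
  nlinarith [Real.sq_sqrt ha, Real.sq_sqrt hb]

section Weight

variable {V : Type*} [Fintype V] (G : SimpleGraph V)

open Classical in
/-- The summand of the geometric-arithmetic index that belongs to an edge. -/
noncomputable def gaWeight : Sym2 V → ℝ :=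
  Sym2.lift ⟨fun u v : V =>
      2 * Real.sqrt ((G.degree u : ℝ) * (G.degree v : ℝ)) /
        ((G.degree u : ℝ) + (G.degree v : ℝ)),
      fun u v => by
        dsimp only
        rw [mul_comm (G.degree u : ℝ) (G.degree v : ℝ),
          add_comm (G.degree u : ℝ) (G.degree v : ℝ)]⟩

theorem gaWeight_mk [DecidableRel G.Adj] (u v : V) : G.gaWeight s(u, v) =
    2 * Real.sqrt ((G.degree u : ℝ) * (G.degree v : ℝ)) /
        ((G.degree u : ℝ) + (G.degree v : ℝ)) := by
  simp only [gaWeight, Sym2.lift_mk]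
  congr!

theorem gaIndex_eq_sum_gaWeight [Fintype G.edgeSet] :
    G.gaIndex = ∑ e ∈ G.edgeFinset, G.gaWeight e := by
  simp only [gaIndex, gaWeight]
  congr!

theorem gaWeight_le_one (e : Sym2 V) : G.gaWeight e ≤ 1 := by
  classical
  induction e with | h u v =>
  rw [gaWeight_mk]
  exact two_mul_sqrt_mul_div_add_le_one (Nat.cast_nonneg _) (Nat.cast_nonneg _)

theorem gaIndex_le_card_edgeFinset [Fintype G.edgeSet] : G.gaIndex ≤ G.edgeFinset.card := by
  rw [gaIndex_eq_sum_gaWeight, Finset.cast_card]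
  exact Finset.sum_le_sum fun e _ => G.gaWeight_le_one e

variable {G}

theorem gaRatio_le_gaWeight [DecidableRel G.Adj] {e : Sym2 V} {c M : ℝ} (hc : 0 < c)
    (h : ∀ w ∈ e, c ≤ G.degree w ∧ G.degree w ≤ M) : gaRatio (M / c) ≤ G.gaWeight e := by
  induction e with | h u v =>
  rw [gaWeight_mk]
  have hu := h u (by simp)
  have hv := h v (by simp)
  exact gaRatio_le hc hu.1 hv.1 hu.2 hv.2

theorem gaRatio_le_gaWeight_of_mem_edgeSet [DecidableRel G.Adj] {e : Sym2 V} {M : ℝ}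
    (he : e ∈ G.edgeSet) (h : ∀ w ∈ e, G.degree w ≤ M) : gaRatio M ≤ G.gaWeight e := by
  rw [← div_one M]
  refine gaRatio_le_gaWeight one_pos fun w hw => ⟨?_, h w hw⟩
  obtain ⟨x, rfl⟩ := hw
  exact_mod_cast (G.degree_pos_iff_exists_adj w).2 ⟨x, he⟩

/-- A graph all of whose vertices have the same positive degree has one unit of
geometric-arithmetic index per edge. -/
theorem IsRegularOfDegree.gaIndex_eq [DecidableRel G.Adj] {d : ℕ}
    (hd : G.IsRegularOfDegree d) (hd0 : d ≠ 0) : G.gaIndex = G.edgeFinset.card := by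
  rw [gaIndex_eq_sum_gaWeight, Finset.cast_card]
  refine Finset.sum_congr rfl fun e _ => ?_
  induction e with | h u v =>
  rw [gaWeight_mk, hd.degree_eq, hd.degree_eq, Real.sqrt_mul_self (Nat.cast_nonneg _)]
  have : (d : ℝ) ≠ 0 := Nat.cast_ne_zero.2 hd0
  field_simp
  norm_num

end Weight

/-- A lower bound for a sum with two kinds of summands. -/
theorem mul_add_mul_le_sum {ι : Type*} {T S : Finset ι} {F : ι → ℝ} {a b : ℝ} {k : ℕ}
    (hST : S ⊆ T) (hk : k ≤ S.card) (ha : ∀ i ∈ T, a ≤ F i) (hb : ∀ i ∈ S, b ≤ F i) :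
    ((T.card : ℝ) - k) * a + k * b ≤ ∑ i ∈ T, F i := by
  classical
  -- Trimming `S` to exactly `k` elements makes a comparison of `a` with `b` unnecessary.
  obtain ⟨R, hRS, rfl⟩ := Finset.exists_subset_card_eq hk
  have hRT := hRS.trans hST
  rw [← Finset.sum_sdiff hRT, ← Nat.cast_sub (Finset.card_le_card hRT),
    ← Finset.card_sdiff_of_subset hRT, ← nsmul_eq_mul, ← nsmul_eq_mul]
  gcongr
  · exact Finset.card_nsmul_le_sum _ _ _ fun i hi => ha i (Finset.sdiff_subset hi)
  · exact Finset.card_nsmul_le_sum _ _ _ fun i hi => hb i (hRS hi)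

/-! ### Lower bounds from the maximum degree -/

section Bounds

variable {V : Type*} [Fintype V] {G : SimpleGraph V} [DecidableRel G.Adj] {v : V} {k : ℕ}

/-- A bound for the geometric-arithmetic index of a unicyclic graph that only uses the maximum
degree. -/
theorem IsUnicyclic.le_gaIndex_of_forall_degree_le (hG : G.IsUnicyclic)
    (hv : ∀ w, G.degree w ≤ G.degree v) :
    ((Fintype.card V : ℝ) - 3) * gaRatio (G.degree v) + 3 * gaRatio (G.degree v / 2)
      ≤ G.gaIndex := by
  classical
  have hcard := hG.card_edgeFinset
  obtain ⟨-, -, ⟨u, c, hc, -⟩, -⟩ := hG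
  obtain ⟨C, hCG, hC3, hC2, -⟩ := hc.exists_edges
  rw [gaIndex_eq_sum_gaWeight, ← hcard]
  have := mul_add_mul_le_sum (F := G.gaWeight) (a := gaRatio (G.degree v))
    (b := gaRatio (G.degree v / 2)) hCG hC3
    (fun e he => gaRatio_le_gaWeight_of_mem_edgeSet (by simpa using he)
      fun w _ => by exact_mod_cast hv w)
    (fun e he => gaRatio_le_gaWeight two_pos
      fun w hw => ⟨by exact_mod_cast hC2 e he w hw, by exact_mod_cast hv w⟩)
  exact_mod_cast this

/-- A bound for the geometric-arithmetic index of a unicyclic graph that treats the edges at a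
vertex of maximum degree and the `k` other edges separately. -/
theorem IsUnicyclic.le_gaIndex_of_degree_add_eq (hG : G.IsUnicyclic)
    (hv : ∀ w, G.degree w ≤ G.degree v) (hk : G.degree v + k = Fintype.card V) :
    G.degree v * gaRatio (G.degree v) +
      (((k : ℝ) - 1) * gaRatio (k + 1) + gaRatio ((k + 1) / 2)) ≤ G.gaIndex := by
  classical
  have hcard := hG.card_edgeFinset
  obtain ⟨-, -, ⟨u, c, hc, -⟩, -⟩ := hG
  obtain ⟨C, hCG, hC3, hC2, hCv⟩ := hc.exists_edges
  have hinc := G.incidenceFinset_subset v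
  have hdeg : ∀ e, e ∈ G.edgeFinset \ G.incidenceFinset v → ∀ w ∈ e,
      (G.degree w : ℝ) ≤ k + 1 := by
    intro e he w hw
    rw [incidenceFinset_eq_filter] at he
    have hvw : v ≠ w := by rintro rfl; simp_all
    have := degree_add_degree_le_card_edgeFinset_add_one (G := G) hvw
    have : G.degree w ≤ k + 1 := by omega
    exact_mod_cast this
  have hcardk : (G.edgeFinset \ G.incidenceFinset v).card = k := by
    rw [Finset.card_sdiff_of_subset hinc, card_incidenceFinset_eq_degree]; omega
  have hS : C.filter (v ∉ ·) ⊆ G.edgeFinset \ G.incidenceFinset v := by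
    intro e he
    rw [incidenceFinset_eq_filter]
    rw [Finset.mem_filter] at he
    have := hCG he.1
    simp_all
  -- At most two of the three or more cycle edges pass through `v`.
  have hS1 : 1 ≤ (C.filter (v ∉ ·)).card := by
    have := Finset.card_filter_add_card_filter_not (s := C) (v ∈ ·)
    have := hCv v
    omega
  rw [gaIndex_eq_sum_gaWeight, ← Finset.sum_sdiff hinc, add_comm]
  refine add_le_add ?_ ?_
  · have := mul_add_mul_le_sum (F := G.gaWeight) (a := gaRatio (k + 1))
      (b := gaRatio ((k + 1) / 2)) hS hS1
      (fun e he => gaRatio_le_gaWeight_of_mem_edgeSet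
        (by simpa using (Finset.mem_sdiff.1 he).1) (hdeg e he))
      (fun e he => gaRatio_le_gaWeight two_pos fun w hw =>
        ⟨by exact_mod_cast hC2 e (Finset.mem_filter.1 he).1 w hw, hdeg e (hS he) w hw⟩)
    rw [hcardk, Nat.cast_one, one_mul] at this
    exact this
  · have := Finset.card_nsmul_le_sum (G.incidenceFinset v) G.gaWeight (gaRatio (G.degree v))
      fun e he => gaRatio_le_gaWeight_of_mem_edgeSet (by simpa using hinc he)
        fun w _ => by exact_mod_cast hv w
    rwa [card_incidenceFinset_eq_degree, nsmul_eq_mul] at this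

/-- A bound for the geometric-arithmetic index of a unicyclic graph that has a universal vertex. -/
theorem IsUnicyclic.le_gaIndex_of_degree_add_one_eq (hG : G.IsUnicyclic)
    (hv : ∀ w, G.degree w ≤ G.degree v) (hk : G.degree v + 1 = Fintype.card V) :
    ((G.degree v : ℝ) - 2) * gaRatio (G.degree v) + 2 * gaRatio (G.degree v / 2) + 1
      ≤ G.gaIndex := by
  classical
  have hcard := hG.card_edgeFinset
  obtain ⟨-, -, ⟨u, c, hc, -⟩, -⟩ := hG
  obtain ⟨C, hCG, hC3, hC2, hCv⟩ := hc.exists_edges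
  have hinc := G.incidenceFinset_subset v
  have hcard1 : (G.edgeFinset \ G.incidenceFinset v).card = 1 := by
    rw [Finset.card_sdiff_of_subset hinc, card_incidenceFinset_eq_degree]; omega
  have hS : C.filter (v ∉ ·) ⊆ G.edgeFinset \ G.incidenceFinset v := by
    intro e he
    rw [incidenceFinset_eq_filter]
    rw [Finset.mem_filter] at he
    have := hCG he.1
    simp_all
  have hadd := Finset.card_filter_add_card_filter_not (s := C) (v ∈ ·)
  have hle := Finset.card_le_card hS
  -- Only one edge misses `v`, and some cycle edge does, so it is that edge.
  have hEq : C.filter (v ∉ ·) = G.edgeFinset \ G.incidenceFinset v :=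
    Finset.eq_of_subset_of_card_le hS (by have := hCv v; omega)
  have hR : C.filter (v ∈ ·) ⊆ G.incidenceFinset v := by
    intro e he
    rw [incidenceFinset_eq_filter]
    rw [Finset.mem_filter] at he ⊢
    exact ⟨hCG he.1, he.2⟩
  rw [gaIndex_eq_sum_gaWeight, ← Finset.sum_sdiff hinc,
    add_comm (∑ e ∈ G.edgeFinset \ G.incidenceFinset v, _)]
  refine add_le_add ?_ ?_
  · have := mul_add_mul_le_sum (F := G.gaWeight) (a := gaRatio (G.degree v))
      (b := gaRatio (G.degree v / 2)) (k := 2) hR (by omega)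
      (fun e he => gaRatio_le_gaWeight_of_mem_edgeSet (by simpa using hinc he)
        fun w _ => by exact_mod_cast hv w)
      (fun e he => gaRatio_le_gaWeight two_pos fun w hw =>
        ⟨by exact_mod_cast hC2 e (Finset.mem_filter.1 he).1 w hw, by exact_mod_cast hv w⟩)
    rw [card_incidenceFinset_eq_degree] at this
    exact_mod_cast this
  · have h1 : ((G.edgeFinset \ G.incidenceFinset v).card : ℝ) = 1 := by exact_mod_cast hcard1
    rw [← h1, ← nsmul_one]
    refine Finset.card_nsmul_le_sum _ _ _ fun e he => ?_
    rw [← hEq, Finset.mem_filter] at he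
    rw [← gaRatio_one, ← div_self (two_ne_zero (α := ℝ))]
    refine gaRatio_le_gaWeight two_pos fun w hw => ⟨by exact_mod_cast hC2 e he.1 w hw, ?_⟩
    have hvw : v ≠ w := by rintro rfl; exact he.2 hw
    -- With `n = d + 1` edges this forces `d(w) ≤ 2`, so both ends of the edge off `v` have degree 2
    -- and its weight is 1.
    have := degree_add_degree_le_card_edgeFinset_add_one (G := G) hvw
    have : G.degree w ≤ 2 := by omega
    exact_mod_cast this

end Bounds

end SimpleGraph

namespace SimpleGraph

/-! ### Real estimates for the index of the extremal graph -/

section Estimates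

theorem gaRatio_sq {s : ℝ} (hs : 0 ≤ s) : gaRatio (s ^ 2) = 2 * s / (1 + s ^ 2) := by
  rw [gaRatio, Real.sqrt_sq hs]

theorem gaRatio_sq_div_two {s : ℝ} (hs : 0 ≤ s) :
    gaRatio (s ^ 2 / 2) = 2 * √2 * s / (s ^ 2 + 2) := by
  have h2 : √2 ^ 2 = 2 := Real.sq_sqrt zero_le_two
  have h0 : √2 ≠ 0 := by positivity
  rw [gaRatio, Real.sqrt_div (sq_nonneg s), Real.sqrt_sq hs]
  field_simp
  rw [h2]
  ring

theorem le_gaRatio {a r : ℝ} (hr : 0 ≤ r) (h : a ^ 2 ≤ r) : 2 * a / (1 + r) ≤ gaRatio r := by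
  rw [gaRatio]
  gcongr
  exact Real.le_sqrt_of_sq_le h

theorem gaRatio_le_of_le_sq {b r : ℝ} (hr : 0 ≤ r) (hb : 0 ≤ b) (h : r ≤ b ^ 2) :
    gaRatio r ≤ 2 * b / (1 + r) := by
  rw [gaRatio]
  gcongr
  exact Real.sqrt_le_iff.2 ⟨hb, h⟩

theorem sqrt_two_bounds : 1.4142 ≤ √2 ∧ √2 ≤ 1.4143 :=
  ⟨Real.le_sqrt_of_sq_le (by norm_num), Real.sqrt_le_iff.2 (by norm_num)⟩

/-- The geometric-arithmetic index of a triangle with `x - 2` pendant vertices attached to one of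
its vertices. -/
noncomputable def gaTriangle (x : ℝ) : ℝ := (x - 2) * gaRatio x + 2 * gaRatio (x / 2) + 1

theorem gaTriangle_sq {t : ℝ} (ht : 0 ≤ t) :
    gaTriangle (t ^ 2) = t * (2 * (t ^ 2 - 2) / (t ^ 2 + 1) + 4 * √2 / (t ^ 2 + 2)) + 1 := by
  rw [gaTriangle, gaRatio_sq ht, gaRatio_sq_div_two ht]
  field_simp
  ring

/-- With `x = t²`, the factor of `t` is `2 - 6/(t² + 1) + 4√2/(t² + 2)`, and `4√2 < 6`. -/
theorem gaTriangle_le {x : ℝ} (hx : 0 ≤ x) : gaTriangle x ≤ 2 * √x + 1 := by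
  obtain ⟨t, ht, rfl⟩ : ∃ t, 0 ≤ t ∧ x = t ^ 2 := ⟨√x, by positivity, (Real.sq_sqrt hx).symm⟩
  rw [gaTriangle_sq ht, Real.sqrt_sq ht, mul_comm 2 t]
  gcongr t * ?_ + 1
  rw [div_add_div _ _ (by positivity) (by positivity), div_le_iff₀ (by positivity)]
  nlinarith [sqrt_two_bounds.2, sq_nonneg t]

theorem gaTriangle_le_of_le_sq {x b : ℝ} (hx : 0 ≤ x) (hb : 0 ≤ b) (h : x ≤ b ^ 2) :
    gaTriangle x ≤ 2 * b + 1 :=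
  (gaTriangle_le hx).trans (by gcongr; exact Real.sqrt_le_iff.2 ⟨hb, h⟩)

/-- Here `y` stands for `(n + 1)/2`, the largest degree allowed by `d ≤ k + 1`. The right side grows
like `2√2·√n`, the left only like `2√n`. -/
theorem gaTriangle_le_of_small_degree {y : ℝ} (hy : 4 ≤ y) :
    gaTriangle (2 * y - 2) ≤ (2 * y - 4) * gaRatio y + 3 * gaRatio (y / 2) := by
  obtain ⟨s, hs, rfl⟩ : ∃ s, 2 ≤ s ∧ y = s ^ 2 :=
    ⟨√y, Real.le_sqrt_of_sq_le (by linarith), (Real.sq_sqrt (by linarith)).symm⟩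
  have hs0 : 0 < s := by linarith
  have h2 : √2 ^ 2 = 2 := Real.sq_sqrt zero_le_two
  -- The tangent bound `√(s² - 1) ≤ s - 1/(2s)`, multiplied by `√2`.
  have hb : 2 * s ^ 2 - 2 ≤ (√2 * (2 * s ^ 2 - 1) / (2 * s)) ^ 2 := by
    rw [div_pow, mul_pow, h2, le_div_iff₀ (by positivity)]
    nlinarith
  refine (gaTriangle_le_of_le_sq (by nlinarith) ?_ hb).trans ?_
  · have : 0 ≤ 2 * s ^ 2 - 1 := by nlinarith
    positivity
  rw [gaRatio_sq hs0.le, gaRatio_sq_div_two hs0.le]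
  have hq := sqrt_two_bounds
  generalize √2 = q at hq
  have key : 0 ≤ (4 * s ^ 3 - 8 * s) / (1 + s ^ 2) - 1 - 1.4143 * (2 * s - 1 / s - 6 *
      s / (s ^ 2 + 2)) := by
    -- Expanded around the left end of the range, the numerator has only nonnegative coefficients in
    -- `u`; the later estimates use the same device.
    obtain ⟨u, hu, rfl⟩ : ∃ u, 0 ≤ u ∧ s = u + 2 := ⟨s - 2, by linarith, by ring⟩
    have : (4 * (u + 2) ^ 3 - 8 * (u + 2)) / (1 + (u + 2) ^ 2) - 1 - 1.4143 * (2 * (u + 2) -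
        1 / (u + 2) - 6 * (u + 2) / ((u + 2) ^ 2 + 2)) = ((4 * (u + 2) ^ 3 - 8 * (u + 2)) * (u +
        2) * ((u + 2) ^ 2 + 2) - (u + 2) * (1 + (u + 2) ^ 2) * ((u + 2) ^ 2 + 2) - 1.4143 * ((2 *
        (u + 2) ^ 2 - 1) * ((u + 2) ^ 2 + 2) - 6 * (u + 2) ^ 2) * (1 + (u + 2) ^ 2)) / ((1 + (u +
        2) ^ 2) * (u + 2) * ((u + 2) ^ 2 + 2)) := by
      field_simp
    rw [this]
    refine div_nonneg ?_ (by positivity)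
    ring_nf
    positivity
  -- The net coefficient of `√2` is nonnegative, so its upper bound 1.4143 may replace it.
  have hnn : 0 ≤ 2 * s - 1 / s - 6 * s / (s ^ 2 + 2) := by
    have : 2 * s - 1 / s - 6 * s / (s ^ 2 + 2)
        = ((2 * s ^ 2 - 1) * (s ^ 2 + 2) - 6 * s ^ 2) / (s * (s ^ 2 + 2)) := by
      field_simp
    rw [this]
    refine div_nonneg ?_ (by positivity)
    nlinarith
  have h3 := mul_le_mul_of_nonneg_right hq.2 hnn
  have e1 : 2 * (q * (2 * s ^ 2 - 1) / (2 * s)) = q * (2 * s - 1 / s) := by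
    field_simp
  have e2 : (2 * s ^ 2 - 4) * (2 * s / (1 + s ^ 2)) = (4 * s ^ 3 - 8 * s) / (1 + s ^ 2) := by
    field_simp; ring
  have e3 : 3 * (2 * q * s / (s ^ 2 + 2)) = q * (6 * s / (s ^ 2 + 2)) := by
    field_simp; ring
  rw [e1, e2, e3]
  linarith

/-- The tangent estimate for the index of a triangle with pendant vertices. -/
theorem gaTriangle_add_le {d j s : ℝ} (hs : 0 < s) (hd : d = s ^ 2) (hj : 0 ≤ j) :
    gaTriangle (d + j) ≤ d * gaRatio d + (2 * s / (1 + s ^ 2) + j / s + 1) := by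
  subst hd
  refine (gaTriangle_le_of_le_sq (b := s + j / (2 * s)) (by positivity) (by positivity) ?_).trans ?_
  · have : s ^ 2 + j = (s + j / (2 * s)) ^ 2 - (j / (2 * s)) ^ 2 := by field_simp; ring
    rw [this]
    exact sub_le_self _ (sq_nonneg _)
  · rw [gaRatio_sq hs.le]
    apply le_of_eq
    field_simp
    ring

/-- The tangent error decreases in `d`, so the worst case is `d = k + 1`, that is `s = t`; an
inequality in `t` alone remains. -/
theorem gaTriangle_le_of_four_le {d k : ℝ} (hk : 4 ≤ k) (hd : k + 1 ≤ d) :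
    gaTriangle (d + (k - 1)) ≤
      d * gaRatio d + ((k - 1) * gaRatio (k + 1) + gaRatio ((k + 1) / 2)) := by
  obtain ⟨s, hs, rfl⟩ : ∃ s, 0 < s ∧ d = s ^ 2 :=
    ⟨√d, Real.sqrt_pos.2 (by linarith), (Real.sq_sqrt (by linarith)).symm⟩
  refine (gaTriangle_add_le hs rfl (by linarith)).trans ?_
  gcongr _ + ?_
  rw [← gaRatio_sq hs.le]
  have hanti := gaRatio_anti (by linarith : 1 ≤ k + 1) hd
  -- 2.23 lies just below `√5`, and `k + 1 ≥ 5`.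
  obtain ⟨t, ht, rfl⟩ : ∃ t, 2.23 ≤ t ∧ k = t ^ 2 - 1 :=
    ⟨√(k + 1), Real.le_sqrt_of_sq_le (by norm_num; linarith),
      by rw [Real.sq_sqrt (by linarith)]; ring⟩
  have ht0 : 0 < t := by norm_num at ht; linarith
  have hts : t ≤ s := by
    rw [sub_add_cancel] at hd
    exact le_of_sq_le_sq hd hs.le
  have hdiv : (t ^ 2 - 1 - 1) / s ≤ (t ^ 2 - 1 - 1) / t := by
    gcongr
    nlinarith
  rw [sub_add_cancel] at *
  rw [gaRatio_sq_div_two ht0.le, gaRatio_sq ht0.le] at *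
  have hq := sqrt_two_bounds.1
  generalize √2 = q at hq
  have hqt : 2 * 1.4142 * t / (t ^ 2 + 2) ≤ 2 * q * t / (t ^ 2 + 2) := by gcongr
  have key : 0 ≤ (t ^ 2 - 1 - 1) * (2 * t / (1 + t ^ 2)) + 2 * 1.4142 * t / (t ^ 2 + 2)
      - 1 - (t ^ 2 - 1 - 1) / t - 2 * t / (1 + t ^ 2) := by
    obtain ⟨u, hu, rfl⟩ : ∃ u, 0 ≤ u ∧ t = u + 2.23 := ⟨t - 2.23, by linarith, by ring⟩
    have : ((u + 2.23) ^ 2 - 1 - 1) * (2 * (u + 2.23) / (1 + (u + 2.23) ^ 2)) + 2 * 1.4142 * (u +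
        2.23) / ((u + 2.23) ^ 2 + 2)
      - 1 - ((u + 2.23) ^ 2 - 1 - 1) / (u + 2.23) - 2 * (u + 2.23) / (1 + (u + 2.23) ^ 2) = (2 *
          (u + 2.23) ^ 2 * ((u + 2.23) ^ 2 - 3) * ((u + 2.23) ^ 2 + 2) + 2 * 1.4142 * (u +
          2.23) ^ 2 * (1 + (u + 2.23) ^ 2) - ((u + 2.23) + (u + 2.23) ^ 2 - 2) * (1 + (u +
          2.23) ^ 2) * ((u + 2.23) ^ 2 + 2)) / ((u + 2.23) * (1 + (u + 2.23) ^ 2) * ((u +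
          2.23) ^ 2 + 2)) := by
      field_simp
      ring
    rw [this]
    refine div_nonneg ?_ (by positivity)
    ring_nf
    positivity
  linarith

theorem gaTriangle_le_of_eq_three {d : ℝ} (hd : 6 ≤ d) :
    gaTriangle (d + 2) ≤ d * gaRatio d + (2 * gaRatio 4 + gaRatio 2) := by
  obtain ⟨s, hs, rfl⟩ : ∃ s, 2.44 ≤ s ∧ d = s ^ 2 :=
    ⟨√d, Real.le_sqrt_of_sq_le (by norm_num; linarith), (Real.sq_sqrt (by linarith)).symm⟩
  have hs0 : 0 < s := by norm_num at hs; linarith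
  refine (gaTriangle_add_le hs0 rfl (by norm_num)).trans ?_
  gcongr _ + ?_
  have h4 := le_gaRatio (a := 2) (r := 4) (by norm_num) (by norm_num)
  have h2 := le_gaRatio (a := 1.414) (r := 2) (by norm_num) (by norm_num)
  have h1 : 2 * s / (1 + s ^ 2) ≤ 0.703 := by
    rw [div_le_iff₀ (by positivity)]; nlinarith
  have h3 : 2 / s ≤ 0.82 := by
    rw [div_le_iff₀ (by positivity)]; linarith
  norm_num at h1 h2 h3 h4
  linarith

/-- The bound `2√x + 1` is too weak for small `d` here: the exact form of `gaTriangle` is kept, and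
only the square root is replaced by its tangent. -/
theorem gaTriangle_le_of_eq_two {d : ℝ} (hd : 5 ≤ d) :
    gaTriangle (d + 1) ≤ d * gaRatio d + (gaRatio 3 + gaRatio (3 / 2)) := by
  obtain ⟨s, hs, rfl⟩ : ∃ s, 2.2 ≤ s ∧ d = s ^ 2 :=
    ⟨√d, Real.le_sqrt_of_sq_le (by norm_num; linarith), (Real.sq_sqrt (by linarith)).symm⟩
  have hs0 : 0 < s := by norm_num at hs; linarith
  have h3 := le_gaRatio (a := 1.732) (r := 3) (by norm_num) (by norm_num)
  have h2 := le_gaRatio (a := 1.224) (r := 3 / 2) (by norm_num) (by norm_num)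
  have ht : √(s ^ 2 + 1) ≤ (2 * s ^ 2 + 1) / (2 * s) := by
    rw [Real.sqrt_le_iff]
    refine ⟨by positivity, ?_⟩
    rw [div_pow, le_div_iff₀ (by positivity)]
    nlinarith
  have hq := sqrt_two_bounds.2
  have hsq : √(s ^ 2 + 1) ^ 2 = s ^ 2 + 1 := Real.sq_sqrt (by positivity)
  have hT := gaTriangle_sq (Real.sqrt_nonneg (s ^ 2 + 1))
  rw [hsq] at hT
  rw [hT, gaRatio_sq hs0.le]
  have hle : √(s ^ 2 + 1) * (2 * (s ^ 2 + 1 - 2) / (s ^ 2 + 1 + 1) + 4 * √2 / (s ^ 2 + 1 + 2)) ≤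
      (2 * s ^ 2 + 1) / (2 * s) *
        (2 * (s ^ 2 + 1 - 2) / (s ^ 2 + 1 + 1) + 4 * 1.4143 / (s ^ 2 + 1 + 2)) := by
    have : 0 ≤ s ^ 2 + 1 - 2 := by nlinarith
    gcongr
  -- 0.845 is just below the rational lower bound for `gaRatio 3 + gaRatio (3 / 2) - 1`.
  have key : 0 ≤ s ^ 2 * (2 * s / (1 + s ^ 2)) + 0.845 - (2 * s ^ 2 + 1) / (2 * s) *
        (2 * (s ^ 2 + 1 - 2) / (s ^ 2 + 1 + 1) + 4 * 1.4143 / (s ^ 2 + 1 + 2)) := by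
    obtain ⟨u, hu, rfl⟩ : ∃ u, 0 ≤ u ∧ s = u + 2.2 := ⟨s - 2.2, by linarith, by ring⟩
    have : (u + 2.2) ^ 2 * (2 * (u + 2.2) / (1 + (u + 2.2) ^ 2)) + 0.845 - (2 * (u + 2.2) ^ 2 +
        1) / (2 * (u + 2.2)) *
        (2 * ((u + 2.2) ^ 2 + 1 - 2) / ((u + 2.2) ^ 2 + 1 + 1) + 4 * 1.4143 / ((u + 2.2) ^ 2 +
            1 + 2)) = ((2 * (u + 2.2) ^ 3 + 0.845 * (1 + (u + 2.2) ^ 2)) * (u + 2.2) * ((u +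
            2.2) ^ 2 + 2) * ((u + 2.2) ^ 2 + 3) - (2 * (u + 2.2) ^ 2 + 1) * (((u + 2.2) ^ 2 -
            1) * ((u + 2.2) ^ 2 + 3) + 2 * 1.4143 * ((u + 2.2) ^ 2 + 2)) * (1 + (u +
            2.2) ^ 2)) / ((u + 2.2) * (1 + (u + 2.2) ^ 2) * ((u + 2.2) ^ 2 + 2) * ((u +
            2.2) ^ 2 + 3)) := by
      have : (u + 2.2) ^ 2 + 1 + 1 = (u + 2.2) ^ 2 + 2 := by ring
      rw [this]
      have : (u + 2.2) ^ 2 + 1 + 2 = (u + 2.2) ^ 2 + 3 := by ring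
      rw [this]
      field_simp
      ring
    rw [this]
    refine div_nonneg ?_ (by positivity)
    ring_nf
    positivity
  norm_num at h2 h3 key hle ⊢
  linarith

end Estimates
end SimpleGraph

namespace SimpleGraph

/-! ### The two extremal graphs and the lower bound -/

section Extremal

theorem two_mul_sqrt_mul_div_add_eq_gaRatio {a b : ℝ} (ha : 0 ≤ a) (hb : 0 < b) :
    2 * √(a * b) / (a + b) = gaRatio (a / b) := by
  obtain ⟨s, hs, rfl⟩ : ∃ s, 0 < s ∧ b = s ^ 2 :=
    ⟨√b, Real.sqrt_pos.2 hb, (Real.sq_sqrt hb.le).symm⟩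
  rw [gaRatio, Real.sqrt_mul ha, Real.sqrt_div ha, Real.sqrt_sq hs.le]
  field_simp
  ring

theorem trianglePendant_adj_iff {n : ℕ} {i j : Fin (n + 3)} :
    (trianglePendant (n + 3)).Adj i j ↔
      i ≠ j ∧ (i = 0 ∨ j = 0 ∨ (i.val < 3 ∧ j.val < 3)) := by
  simp only [trianglePendant, fromRel_adj, Fin.ext_iff, Fin.val_zero, ne_eq]
  omega

theorem trianglePendant_connected (n : ℕ) : (trianglePendant (n + 3)).Connected := by
  refine (connected_iff_exists_forall_reachable _).2 ⟨0, fun w => ?_⟩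
  by_cases hw : w = 0
  · rw [hw]
  · exact (trianglePendant_adj_iff.2 ⟨Ne.symm hw, Or.inl rfl⟩).reachable

theorem edgeFinset_trianglePendant (n : ℕ) [Fintype (trianglePendant (n + 3)).edgeSet] :
    (trianglePendant (n + 3)).edgeFinset =
      insert s(1, 2) (Finset.univ.image fun i : Fin (n + 2) => s(0, i.succ)) := by
  ext e
  induction e with | h i j =>
  simp only [mem_edgeFinset, mem_edgeSet, trianglePendant_adj_iff, Finset.mem_insert,
    Finset.mem_image, Finset.mem_univ, true_and, Sym2.eq_iff]
  constructor
  · rintro ⟨hij, rfl | rfl | h⟩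
    · obtain ⟨k, rfl⟩ := Fin.exists_succ_eq.2 hij.symm
      exact Or.inr ⟨k, Or.inl ⟨rfl, rfl⟩⟩
    · obtain ⟨k, rfl⟩ := Fin.exists_succ_eq.2 hij
      exact Or.inr ⟨k, Or.inr ⟨rfl, rfl⟩⟩
    · by_cases hi : i = 0
      · obtain ⟨k, rfl⟩ := Fin.exists_succ_eq.2 (hi ▸ hij.symm)
        exact Or.inr ⟨k, Or.inl ⟨hi.symm, rfl⟩⟩
      · by_cases hj : j = 0
        · obtain ⟨k, rfl⟩ := Fin.exists_succ_eq.2 hi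
          exact Or.inr ⟨k, Or.inr ⟨hj.symm, rfl⟩⟩
        · left
          simp only [Fin.ext_iff, Fin.val_zero, Fin.val_one, Fin.val_two, ne_eq] at *
          omega
  · have h12 : (1 : Fin (n + 3)) ≠ 2 := by
      simp only [ne_eq, Fin.ext_iff, Fin.val_one, Fin.val_two]
      omega
    have hval : (1 : Fin (n + 3)).val < 3 ∧ (2 : Fin (n + 3)).val < 3 := by
      simp only [Fin.val_one, Fin.val_two]
      omega
    rintro ((⟨rfl, rfl⟩ | ⟨rfl, rfl⟩) | ⟨k, ⟨rfl, rfl⟩ | ⟨rfl, rfl⟩⟩)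
    · exact ⟨h12, Or.inr (Or.inr hval)⟩
    · exact ⟨h12.symm, Or.inr (Or.inr hval.symm)⟩
    · exact ⟨(Fin.succ_ne_zero k).symm, Or.inl rfl⟩
    · exact ⟨Fin.succ_ne_zero k, Or.inr (Or.inl rfl)⟩

theorem injective_mk_zero_succ (n : ℕ) :
    Function.Injective fun i : Fin (n + 2) => s((0 : Fin (n + 3)), i.succ) := by
  intro i j h
  simpa [Sym2.eq_iff] using h

theorem mk_one_two_notMem (n : ℕ) : s((1 : Fin (n + 3)), 2) ∉
    Finset.univ.image fun i : Fin (n + 2) => s((0 : Fin (n + 3)), i.succ) := by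
  simp only [Finset.mem_image, Finset.mem_univ, true_and, Sym2.eq_iff, not_exists]
  rintro k (⟨h, -⟩ | ⟨h, -⟩) <;>
  · simp only [Fin.ext_iff, Fin.val_zero, Fin.val_one, Fin.val_two] at h
    omega

theorem card_edgeFinset_trianglePendant (n : ℕ) [Fintype (trianglePendant (n + 3)).edgeSet] :
    (trianglePendant (n + 3)).edgeFinset.card = n + 3 := by
  rw [edgeFinset_trianglePendant, Finset.card_insert_of_notMem (mk_one_two_notMem n),
    Finset.card_image_of_injective _ (injective_mk_zero_succ n), Finset.card_univ, Fintype.card_fin]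

theorem isUnicyclic_trianglePendant {n : ℕ} (hn : 3 ≤ n) : (trianglePendant n).IsUnicyclic := by
  classical
  obtain ⟨m, rfl⟩ := Nat.exists_eq_add_of_le' hn
  refine (trianglePendant_connected m).isUnicyclic_of_card_edgeFinset ?_
  rw [card_edgeFinset_trianglePendant, Fintype.card_fin]

theorem degree_trianglePendant_zero (n : ℕ) [DecidableRel (trianglePendant (n + 3)).Adj] :
    (trianglePendant (n + 3)).degree 0 = n + 2 := by
  have : (trianglePendant (n + 3)).neighborFinset 0 = Finset.univ.erase 0 := by
    ext j
    simp [trianglePendant_adj_iff, eq_comm]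
  rw [← card_neighborFinset_eq_degree, this, Finset.card_erase_of_mem (Finset.mem_univ _),
    Finset.card_univ, Fintype.card_fin]
  rfl

theorem degree_trianglePendant_one (n : ℕ) [DecidableRel (trianglePendant (n + 3)).Adj] :
    (trianglePendant (n + 3)).degree 1 = 2 := by
  have : (trianglePendant (n + 3)).neighborFinset 1 = {0, 2} := by
    ext j
    simp only [mem_neighborFinset, trianglePendant_adj_iff, Finset.mem_insert,
      Finset.mem_singleton, Fin.ext_iff, Fin.val_zero, Fin.val_one, Fin.val_two, ne_eq]
    omega
  rw [← card_neighborFinset_eq_degree, this, Finset.card_pair]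
  simp only [ne_eq, Fin.ext_iff, Fin.val_zero, Fin.val_two]
  omega

theorem degree_trianglePendant_two (n : ℕ) [DecidableRel (trianglePendant (n + 3)).Adj] :
    (trianglePendant (n + 3)).degree 2 = 2 := by
  have : (trianglePendant (n + 3)).neighborFinset 2 = {0, 1} := by
    ext j
    simp only [mem_neighborFinset, trianglePendant_adj_iff, Finset.mem_insert,
      Finset.mem_singleton, Fin.ext_iff, Fin.val_zero, Fin.val_one, Fin.val_two, ne_eq]
    omega
  rw [← card_neighborFinset_eq_degree, this, Finset.card_pair Fin.zero_ne_one]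

theorem degree_trianglePendant_of_three_le {n : ℕ} [DecidableRel (trianglePendant (n + 3)).Adj]
    {i : Fin (n + 3)} (hi : 3 ≤ i.val) : (trianglePendant (n + 3)).degree i = 1 := by
  have : (trianglePendant (n + 3)).neighborFinset i = {0} := by
    ext j
    simp only [mem_neighborFinset, trianglePendant_adj_iff, Finset.mem_singleton, Fin.ext_iff,
      Fin.val_zero, ne_eq]
    omega
  rw [← card_neighborFinset_eq_degree, this, Finset.card_singleton]

theorem gaIndex_trianglePendant (n : ℕ) :
    (trianglePendant (n + 3)).gaIndex = gaTriangle (n + 2) := by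
  classical
  have h1 : (Fin.succ (0 : Fin (n + 2))) = 1 := rfl
  have h2 : (Fin.succ (Fin.succ (0 : Fin (n + 1)))) = 2 := rfl
  have hn : (0 : ℝ) ≤ (n + 2 : ℕ) := Nat.cast_nonneg _
  rw [gaIndex_eq_sum_gaWeight, edgeFinset_trianglePendant,
    Finset.sum_insert (mk_one_two_notMem n),
    Finset.sum_image (injective_mk_zero_succ n).injOn, Fin.sum_univ_succ, Fin.sum_univ_succ]
  rw [h1, h2, gaWeight_mk, gaWeight_mk, gaWeight_mk]
  have hsum : ∀ i : Fin n, (trianglePendant (n + 3)).gaWeight s(0, i.succ.succ.succ) =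
      gaRatio (n + 2) := by
    intro i
    rw [gaWeight_mk, degree_trianglePendant_zero,
      degree_trianglePendant_of_three_le (by simp),
      two_mul_sqrt_mul_div_add_eq_gaRatio hn (by norm_num)]
    simp
  rw [Finset.sum_congr rfl fun i _ => hsum i, degree_trianglePendant_zero,
    degree_trianglePendant_one, degree_trianglePendant_two,
    two_mul_sqrt_mul_div_add_eq_gaRatio hn (by norm_num),
    two_mul_sqrt_mul_div_add_eq_gaRatio (by norm_num) (by norm_num), div_self (by norm_num),
    gaRatio_one, gaTriangle]
  simp
  ring

theorem card_edgeFinset_of_isRegularOfDegree_two {V : Type*} [Fintype V] {G : SimpleGraph V}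
    [DecidableRel G.Adj] (h : G.IsRegularOfDegree 2) : G.edgeFinset.card = Fintype.card V := by
  have := G.sum_degrees_eq_twice_card_edges
  simp only [h.degree_eq, Finset.sum_const, Finset.card_univ, smul_eq_mul] at this
  omega

theorem isRegularOfDegree_cycleGraph (n : ℕ) : (cycleGraph (n + 3)).IsRegularOfDegree 2 :=
  fun _ => cycleGraph_degree_three_le

theorem isUnicyclic_cycleGraph {n : ℕ} (hn : 3 ≤ n) : (cycleGraph n).IsUnicyclic := by
  obtain ⟨m, rfl⟩ := Nat.exists_eq_add_of_le' hn
  exact cycleGraph_connected.isUnicyclic_of_card_edgeFinset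
    (card_edgeFinset_of_isRegularOfDegree_two (isRegularOfDegree_cycleGraph m))

theorem gaIndex_cycleGraph {n : ℕ} (hn : 3 ≤ n) : (cycleGraph n).gaIndex = n := by
  obtain ⟨m, rfl⟩ := Nat.exists_eq_add_of_le' hn
  rw [(isRegularOfDegree_cycleGraph m).gaIndex_eq two_ne_zero,
    card_edgeFinset_of_isRegularOfDegree_two (isRegularOfDegree_cycleGraph m), Fintype.card_fin]

/-- No estimate is needed: this is the upper bound applied to the triangle with pendant vertices. -/
theorem gaTriangle_le_card (n : ℕ) : gaTriangle (n + 2) ≤ n + 3 := by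
  classical
  rw [← gaIndex_trianglePendant]
  refine (gaIndex_le_card_edgeFinset _).trans ?_
  rw [card_edgeFinset_trianglePendant]
  norm_num

theorem gaTriangle_sub_one_eq {x : ℝ} (hx : 1 ≤ x) :
    gaTriangle (x - 1) =
      1 + ((2 * x ^ 2 + 4 * (√2 - 1) * x - 6) * √(x - 1)) / (x * (x + 1)) := by
  have h := gaTriangle_sq (Real.sqrt_nonneg (x - 1))
  rw [Real.sq_sqrt (by linarith)] at h
  have h1 : x - 1 + 1 = x := by ring
  have h2 : x - 1 + 2 = x + 1 := by ring
  rw [h, h1, h2]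
  field_simp
  ring

theorem IsUnicyclic.gaTriangle_le_gaIndex {V : Type*} [Fintype V] {G : SimpleGraph V}
    (hG : G.IsUnicyclic) : gaTriangle (Fintype.card V - 1) ≤ G.gaIndex := by
  classical
  have hcard := hG.card_edgeFinset
  have : Nonempty V := hG.1.nonempty
  obtain ⟨v, hv⟩ := G.exists_maximal_degree_vertex
  replace hv : ∀ w, G.degree w ≤ G.degree v := fun w => hv ▸ G.degree_le_maxDegree w
  have hlt := G.degree_lt_card_verts v
  have hsum := G.sum_degrees_eq_twice_card_edges
  have hA := hG.le_gaIndex_of_forall_degree_le hv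
  obtain hd | hd := Nat.lt_or_ge (G.degree v) 3
  -- The degrees sum to `2n` and none exceeds 2, so all equal 2.
  · have hreg : G.IsRegularOfDegree 2 := by
      have h2 : ∑ w, G.degree w = ∑ _w : V, 2 := by simp [hsum, hcard, mul_comm]
      intro w
      exact (Finset.sum_eq_sum_iff_of_le fun w _ => by have := hv w; omega).1 h2 w
        (Finset.mem_univ w)
    rw [hreg.gaIndex_eq two_ne_zero, hcard]
    have hv2 := hreg.degree_eq v
    obtain ⟨m, hm⟩ := Nat.exists_eq_add_of_le' (show 3 ≤ Fintype.card V by omega)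
    rw [hm]
    have := gaTriangle_le_card m
    push_cast
    convert this using 2
    ring
  obtain ⟨k, hk⟩ := Nat.exists_eq_add_of_le hlt.le
  have hB := hG.le_gaIndex_of_degree_add_eq hv hk.symm
  have hx : (Fintype.card V : ℝ) - 1 = G.degree v + (k - 1) := by
    rw [hk]; push_cast; ring
  have hC := hG.le_gaIndex_of_degree_add_one_eq hv
  rw [hx]
  have hV : (Fintype.card V : ℝ) = G.degree v + k := by exact_mod_cast hk
  rw [hV] at hA
  have hk0 : 1 ≤ k := by omega
  rw [hk] at hC
  generalize G.degree v = d at *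
  obtain rfl | hk1 := hk0.eq_or_lt
  · simpa [gaTriangle] using hC rfl
  by_cases hkd : d ≤ k + 1
  -- `gaTriangle_le_of_small_degree` needs `(n + 1)/2 ≥ 4`, so `n ≤ 6` is treated by hand.
  · by_cases hsmall : d + k ≤ 6
    · refine le_trans ?_ hA
      have hd3 : d = 3 := by omega
      subst hd3
      have h3 := le_gaRatio (a := 1.732) (r := 3) (by norm_num) (by norm_num)
      have h2 := le_gaRatio (a := 1.224) (r := 3 / 2) (by norm_num) (by norm_num)
      have : k = 2 ∨ k = 3 := by omega
      obtain rfl | rfl := this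
      · have h4 := gaRatio_le_of_le_sq (b := 2) (r := 4) (by norm_num) (by norm_num) (by norm_num)
        have h5 := gaRatio_le_of_le_sq (b := 1.4143) (r := 2) (by norm_num) (by norm_num)
          (by norm_num)
        norm_num [gaTriangle] at *
        linarith
      · have h4 := gaRatio_le_of_le_sq (b := 2.24) (r := 5) (by norm_num) (by norm_num)
          (by norm_num)
        have h5 := gaRatio_le_of_le_sq (b := 1.6) (r := 5 / 2) (by norm_num) (by norm_num)
          (by norm_num)
        norm_num [gaTriangle] at *
        linarith
    · have hn : (7 : ℝ) ≤ d + k := by exact_mod_cast (by omega : 7 ≤ d + k)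
      have hdk : (d : ℝ) ≤ k + 1 := by exact_mod_cast hkd
      have hd' : (3 : ℝ) ≤ d := by exact_mod_cast hd
      -- Since `d ≤ (n + 1)/2`, passing from `d` to this value only lowers the weights.
      have h := gaTriangle_le_of_small_degree (y := (d + k + 1) / 2) (by linarith)
      have h1 := gaRatio_anti (by linarith : (1 : ℝ) ≤ d) (q := (d + k + 1) / 2) (by linarith)
      have h2 := gaRatio_anti (by linarith : (1 : ℝ) ≤ d / 2) (q := (d + k + 1) / 2 / 2)
        (by linarith)
      have e1 : (2 : ℝ) * ((d + k + 1) / 2) - 2 = d + (k - 1) := by ring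
      have e2 : (2 : ℝ) * ((d + k + 1) / 2) - 4 = d + k - 3 := by ring
      rw [e1, e2] at h
      have h3 := mul_le_mul_of_nonneg_left h1 (by linarith : (0 : ℝ) ≤ d + k - 3)
      linarith
  refine le_trans ?_ hB
  push Not at hkd
  obtain hk4 | hk4 := Nat.lt_or_ge k 4
  · have : k = 2 ∨ k = 3 := by omega
    obtain rfl | rfl := this
    · obtain rfl | hd5 : d = 4 ∨ 5 ≤ d := by omega
      · have h3 := le_gaRatio (a := 1.73205) (r := 3) (by norm_num) (by norm_num)
        have h2 := le_gaRatio (a := 1.2247) (r := 3 / 2) (by norm_num) (by norm_num)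
        have h1 := le_gaRatio (a := 2) (r := 4) (by norm_num) (by norm_num)
        have h4 := gaRatio_le_of_le_sq (b := 2.2361) (r := 5) (by norm_num) (by norm_num)
          (by norm_num)
        have h5 := gaRatio_le_of_le_sq (b := 1.5812) (r := 5 / 2) (by norm_num) (by norm_num)
          (by norm_num)
        norm_num [gaTriangle] at *
        linarith
      · have := gaTriangle_le_of_eq_two (d := d) (by exact_mod_cast hd5)
        norm_num at *
        exact this
    · obtain rfl | hd6 : d = 5 ∨ 6 ≤ d := by omega
      · have h3 := le_gaRatio (a := 2.236) (r := 5) (by norm_num) (by norm_num)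
        have h2 := le_gaRatio (a := 1.414) (r := 2) (by norm_num) (by norm_num)
        have h1 := le_gaRatio (a := 2) (r := 4) (by norm_num) (by norm_num)
        have h4 := gaRatio_le_of_le_sq (b := 2.65) (r := 7) (by norm_num) (by norm_num)
          (by norm_num)
        have h5 := gaRatio_le_of_le_sq (b := 1.88) (r := 7 / 2) (by norm_num) (by norm_num)
          (by norm_num)
        norm_num [gaTriangle] at *
        linarith
      · have := gaTriangle_le_of_eq_three (d := d) (by exact_mod_cast hd6)
        norm_num at *
        exact this
  · exact gaTriangle_le_of_four_le (by exact_mod_cast hk4) (by exact_mod_cast hkd.le)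

end Extremal

end SimpleGraph

theorem mainTheorem1 (n : ℕ) (hn : 3 ≤ n) :
    (SimpleGraph.trianglePendant n).IsUnicyclic ∧
    (SimpleGraph.cycleGraph n).IsUnicyclic ∧
    (SimpleGraph.trianglePendant n).gaIndex =
      1 + ((2 * (n : ℝ) ^ 2 + 4 * (Real.sqrt 2 - 1) * (n : ℝ) - 6) * Real.sqrt ((n : ℝ) - 1)) /
        ((n : ℝ) * ((n : ℝ) + 1)) ∧
    (SimpleGraph.cycleGraph n).gaIndex = (n : ℝ) ∧
    ∀ (V : Type*) [Fintype V] (G : SimpleGraph V), Fintype.card V = n → G.IsUnicyclic →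
      (SimpleGraph.trianglePendant n).gaIndex ≤ G.gaIndex ∧
      G.gaIndex ≤ (SimpleGraph.cycleGraph n).gaIndex := by
  have hS : (SimpleGraph.trianglePendant n).gaIndex = SimpleGraph.gaTriangle ((n : ℝ) - 1) := by
    obtain ⟨m, rfl⟩ := Nat.exists_eq_add_of_le' hn
    rw [SimpleGraph.gaIndex_trianglePendant]
    push_cast
    ring_nf
  refine ⟨SimpleGraph.isUnicyclic_trianglePendant hn, SimpleGraph.isUnicyclic_cycleGraph hn, ?_,
    SimpleGraph.gaIndex_cycleGraph hn, ?_⟩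
  · rw [hS, SimpleGraph.gaTriangle_sub_one_eq]
    exact_mod_cast (by omega : 1 ≤ n)
  · classical
    intro V _ G hV hG
    rw [hS, SimpleGraph.gaIndex_cycleGraph hn, ← hV]
    refine ⟨hG.gaTriangle_le_gaIndex, ?_⟩
    rw [← hG.card_edgeFinset]
    exact G.gaIndex_le_card_edgeFinset
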